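/- Let $H\in(0,1)$ and $\alpha=2H\in(0,2)$. Let $Y=\{Y(k)\}_{k\ge 0}$ be one of the following: (a) a standard fractional Gaussian noise, $Y(k)=B_H(k+1)-B_H(k)$, where $B_H$ is a standard fractional Brownian motion, i.e. a centered Gaussian process on $\mathbb{R}$ with $\mathbb{E}B_H(s)B_H(t)=\frac12\{|s|^{2H}+|t|^{2H}-|s-t|^{2H}\}$; (b) with $H\neq\frac12$, a stationary fractional Ornstein–Uhlenbeck process with parameters $\lambda,\sigma>0$ observed at integer times, i.e. $Y(k)=V(k)$ where $\{V(t)\}_{t\ge0}$ is an almost surely continuous, centered, Gaussian, stationary solution of $dV(t)=-\lambda V(t)\,dt+\sigma\,dB_H(t)$, $t\ge0$ (meaning that almost surely $V(t)=V(0)-\lambda\int_0^tV(u)\,du+\sigma (B_H(t)-B_H(0))$ for all $t\ge 0$). Let $\gamma_Y$ be the autocovariance function of $Y$. For a fixed integer $n\ge1$ let $\widetilde Z_n(k)=\sigma(n)[Y(n+k)-Y(k)]$, $k\ge0$, where $\sigma(n)=\mathrm{Var}(Y(n)-Y(0))^{-1/2}$. Then $\mathrm{Var}\,\widetilde Z_n(k)=1$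 for all $k$, and $Y$ and $\widetilde Z_n$ have autocovariance functions $\gamma_Y$ and $\gamma_{\widetilde Z_n}$ (the covariances $\mathrm{Cov}(Y(j),Y(j+k))$ and $\mathrm{Cov}(\widetilde Z_n(j),\widetilde Z_n(j+k))$ do not depend on $j$). As $k\to\infty$, $$\gamma_Y(k)=\frac{\alpha(\alpha-1)}{2}k^{\alpha-2}+O(k^{\alpha-3})\ \text{ in case (a)},\qquad \gamma_Y(k)=\frac{\sigma^2\alpha(\alpha-1)}{2\lambda^2}k^{\alpha-2}+O(k^{\alpha-3})\ \text{ in case (b)},$$ and in both cases $$\gamma_{\widetilde Z_n}(k)=O(k^{\alpha-3}),\qquad \sum_{k=1}^\infty|\gamma_{\widetilde Z_n}(k)|<\infty,\qquad \sum_{k=1}^\infty|\gamma_{\widetilde Z_n}(k)|^2<\infty .$$ -/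

import Mathlib

open MeasureTheory ProbabilityTheory Filter Asymptotics
open scoped NNReal

/-- `B` is a standard fractional Brownian motion with Hurst parameter `H`: a centered Gaussian
process on the real line with `E[B(s) B(t)] = (|s|^{2H} + |t|^{2H} - |s - t|^{2H}) / 2`.
(Continuity of paths is not required here, so every version is allowed.) -/
structure IsFractionalBrownianMotion {Ω : Type*} [MeasurableSpace Ω]
    (B : ℝ → Ω → ℝ) (H : ℝ) (P : Measure Ω) : Prop where
  gaussian : IsGaussianProcess B P
  centered : ∀ t, ∫ ω, B t ω ∂P = 0
  covariance : ∀ s t, ∫ ω, B s ω * B t ω ∂P =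
    (|s| ^ (2 * H) + |t| ^ (2 * H) - |s - t| ^ (2 * H)) / 2

/-- `X` is a (standard) fractional Gaussian noise with Hurst parameter `H`: the sequence of unit
increments of a standard fractional Brownian motion. -/
def IsFractionalGaussianNoise {Ω : Type*} [MeasurableSpace Ω]
    (X : ℕ → Ω → ℝ) (H : ℝ) (P : Measure Ω) : Prop :=
  ∃ B : ℝ → Ω → ℝ, IsFractionalBrownianMotion B H P ∧
    ∀ (k : ℕ) (ω : Ω), X k ω = B ((k : ℝ) + 1) ω - B (k : ℝ) ω

/-- Strict stationarity of a process on `[0, ∞)`: the finite dimensional distributions are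
invariant under time shifts. -/
def IsStrictlyStationary {Ω : Type*} [MeasurableSpace Ω]
    (V : ℝ≥0 → Ω → ℝ) (P : Measure Ω) : Prop :=
  ∀ (h : ℝ≥0) (I : Finset ℝ≥0),
    IdentDistrib (fun ω (i : I) => V ((i : ℝ≥0) + h) ω) (fun ω (i : I) => V (i : ℝ≥0) ω) P P

/-- `V` is a stationary fractional Ornstein-Uhlenbeck process with drift parameter `lam`, diffusion
parameter `s` and Hurst parameter `H`: an almost surely continuous, Gaussian, centered and
stationary solution of the Langevin equation `dV(t) = - lam V(t) dt + s dB(t)`, `t ≥ 0`, where `B`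
is a standard fractional Brownian motion. As the noise is additive, the equation is the
pathwise integral equation `V(t) = V(0) - lam ∫_0^t V(u) du + s (B(t) - B(0))`. -/
structure IsFractionalOrnsteinUhlenbeck {Ω : Type*} [MeasurableSpace Ω]
    (V : ℝ≥0 → Ω → ℝ) (lam s H : ℝ) (P : Measure Ω) : Prop where
  gaussian : IsGaussianProcess V P
  centered : ∀ t, ∫ ω, V t ω ∂P = 0
  stationary : IsStrictlyStationary V P
  continuous : ∀ᵐ ω ∂P, Continuous fun t => V t ω
  langevin : ∃ B : ℝ → Ω → ℝ, IsFractionalBrownianMotion B H P ∧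
    ∀ᵐ ω ∂P, ∀ t : ℝ≥0,
      V t ω = V 0 ω - lam * (∫ u in (0 : ℝ)..(t : ℝ), V u.toNNReal ω)
        + s * (B (t : ℝ) ω - B 0 ω)

/-- `Y` is a stationary fractional Ornstein-Uhlenbeck process observed at the times
`0, 1, 2, …`. -/
def IsFractionalOUSequence {Ω : Type*} [MeasurableSpace Ω]
    (Y : ℕ → Ω → ℝ) (lam s H : ℝ) (P : Measure Ω) : Prop :=
  ∃ V : ℝ≥0 → Ω → ℝ, IsFractionalOrnsteinUhlenbeck V lam s H P ∧
    ∀ (k : ℕ) (ω : Ω), Y k ω = V (k : ℝ≥0) ω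

/-- `γ` is the autocovariance function of the sequence `X`:
`Cov(X(j), X(j + k)) = γ(k)` for all `j` and `k`. -/
def HasAutocovariance {Ω : Type*} [MeasurableSpace Ω]
    (X : ℕ → Ω → ℝ) (γ : ℕ → ℝ) (P : Measure Ω) : Prop :=
  ∀ j k : ℕ, covariance (X j) (X (j + k)) P = γ k

/-- The autocovariance `k ↦ Cov(X(0), X(k))`. -/
noncomputable def autocov {Ω : Type*} [MeasurableSpace Ω]
    (X : ℕ → Ω → ℝ) (P : Measure Ω) (k : ℕ) : ℝ :=
  covariance (X 0) (X k) P

/-- The normalizing factor `σ(n) = Var(Y(n) - Y(0))^{-1/2}`. -/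
noncomputable def incrementScale {Ω : Type*} [MeasurableSpace Ω]
    (Y : ℕ → Ω → ℝ) (P : Measure Ω) (n : ℕ) : ℝ :=
  (√(variance (fun ω => Y n ω - Y 0 ω) P))⁻¹

/-- The normalized increment sequence `Z_n(k) = σ(n) [Y(n + k) - Y(k)]`. -/
noncomputable def normalizedIncrement {Ω : Type*} [MeasurableSpace Ω]
    (Y : ℕ → Ω → ℝ) (P : Measure Ω) (n : ℕ) (k : ℕ) (ω : Ω) : ℝ :=
  incrementScale Y P n * (Y (n + k) ω - Y k ω)

/-! In case (a) the autocovariance is half the second difference of `|k| ^ α`, so the expansion is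
Taylor's formula. In case (b) let `r` be the autocovariance of `V`. Solve the Langevin equation for
the noise, `s (B(t) - B(0)) = V(t) - V(0) + lam ∫ V`, and take variances. The cross term vanishes by
stationarity, which leaves `2 (r(0) - r(t)) + 2 lam² ∫ (t - u) r(u) du = s² t^α`
(`extendedAutocov_eq`). Hence `r'' = lam² r - (s²/2) α (α - 1) t^(α-2)`. As `r` is bounded, no
exponentially growing mode occurs; subtracting the leading term leaves a forcing of order `t^(α-4)`,
and a maximum principle bounds the remainder (`isBigO_rpow_of_deriv2_eq`). The autocovariance of the
increments is a multiple of `2γ(k) - γ(k+n) - γ(k-n)`, in which the leading terms cancel up to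
`O(k^(α-3))`; this is summable because `α - 3 < -1`. The normalization is legitimate because `γ(n) =
γ(0)` would make `γ` periodic, against `γ → 0` and `γ(0) ≠ 0`. -/

/-! ### Maximum principle for `w'' = L w - h` -/

/-- A twice differentiable function on `[T, ∞)` which is nonnegative at `T` and near `∞`, and
whose second derivative is negative wherever the function is, is nonnegative. -/
theorem nonneg_of_deriv2_neg_of_neg {u u' u'' : ℝ → ℝ} {T : ℝ}
    (hu : ∀ t, T ≤ t → HasDerivAt u (u' t) t) (hu' : ∀ t, T ≤ t → HasDerivAt u' (u'' t) t)
    (hT : 0 ≤ u T) (htop : ∀ᶠ t in atTop, 0 ≤ u t)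
    (hneg : ∀ t, T ≤ t → u t < 0 → u'' t < 0) {t : ℝ} (ht : T ≤ t) : 0 ≤ u t := by
  by_contra! hlt
  obtain ⟨R, hR, htR⟩ := (htop.and (eventually_ge_atTop t)).exists
  obtain ⟨y, hy, hmin⟩ := isCompact_Icc.exists_isMinOn (Set.nonempty_Icc.2 (ht.trans htR))
    (fun x hx => (hu x hx.1).continuousAt.continuousWithinAt : ContinuousOn u (Set.Icc T R))
  have hyneg : u y < 0 := (hmin ⟨ht, htR⟩).trans_lt hlt
  have hTy : T < y := lt_of_le_of_ne hy.1 fun h => by rw [← h] at hyneg; linarith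
  have hyR : y < R := lt_of_le_of_ne hy.2 fun h => by rw [h] at hyneg; linarith
  have hlocmin : IsLocalMin u y := hmin.isLocalMin (Icc_mem_nhds hTy hyR)
  have hderiv : deriv u =ᶠ[nhds y] u' := by
    filter_upwards [Ioi_mem_nhds hTy] with x hx using (hu x (le_of_lt hx)).deriv
  have h1 : deriv u y = 0 := hlocmin.deriv_eq_zero
  have h2 : deriv (deriv u) y = u'' y := by
    rw [hderiv.deriv_eq, (hu' y hTy.le).deriv]
  -- A negative second derivative makes the minimum a local maximum too, so `u` is locally constant
  -- and its second derivative is zero.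
  have hlocmax : IsLocalMax u y :=
    isLocalMax_of_deriv_deriv_neg (h2 ▸ hneg y hTy.le hyneg) h1 (hu y hTy.le).continuousAt
  have hconst : u =ᶠ[nhds y] fun _ => u y := by
    filter_upwards [hlocmin, hlocmax] with x hx hx' using le_antisymm hx' hx
  have h3 : deriv (deriv u) y = 0 := by
    rw [hconst.deriv.deriv_eq]; simp
  have := hneg y hTy.le hyneg
  linarith

/-- The barrier is `C t^p + ε t`. Its linear part beats the bound `M` near infinity, and `ε → 0`
removes it. Where `w` exceeds the barrier, the curvature of `C t^p` and the forcing `h` each use at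
most half of `L C t^p` (by `hTp` and `hKC`), so the second derivative of barrier minus `w` is
negative. -/
theorem le_rpow_of_deriv2_eq {w w' w'' h : ℝ → ℝ} {T L K C M p : ℝ} (hL : 0 < L) (hT : 0 < T)
    (hw : ∀ t, T ≤ t → HasDerivAt w (w' t) t) (hw' : ∀ t, T ≤ t → HasDerivAt w' (w'' t) t)
    (hode : ∀ t, T ≤ t → w'' t = L * w t - h t) (hh : ∀ t, T ≤ t → |h t| ≤ K * t ^ p)
    (hM : ∀ t, T ≤ t → w t ≤ M) (hC : 0 ≤ C) (hTp : 2 * |p * (p - 1)| ≤ L * T ^ 2)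
    (hKC : 2 * K ≤ L * C) (hMC : M ≤ C * T ^ p) {t : ℝ} (ht : T ≤ t) : w t ≤ C * t ^ p := by
  refine le_of_forall_pos_le_add fun δ hδ => ?_
  have htpos : 0 < t := hT.trans_le ht
  -- With this slope the linear part equals `δ` at the given point.
  set ε := δ / t with hε
  have hεpos : 0 < ε := div_pos hδ htpos
  have key : 0 ≤ C * t ^ p + ε * t - w t := by
    refine nonneg_of_deriv2_neg_of_neg (u := fun t => C * t ^ p + ε * t - w t)
      (u' := fun t => C * (p * t ^ (p - 1)) + ε - w' t)
      (u'' := fun t => C * (p * ((p - 1) * t ^ (p - 1 - 1))) - w'' t) (T := T) ?_ ?_ ?_ ?_ ?_ ht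
    · intro x hx
      have hx0 : x ≠ 0 := (hT.trans_le hx).ne'
      have := (((Real.hasDerivAt_rpow_const (p := p) (Or.inl hx0)).const_mul C).add
        ((hasDerivAt_id x).const_mul ε)).sub (hw x hx)
      exact this.congr_deriv (by ring)
    · intro x hx
      have hx0 : x ≠ 0 := (hT.trans_le hx).ne'
      exact (((((Real.hasDerivAt_rpow_const (p := p - 1) (Or.inl hx0)).const_mul p).const_mul
        C)).add_const ε).sub (hw' x hx)
    · have := hM T le_rfl
      have := mul_pos hεpos hT
      linarith
    · filter_upwards [eventually_ge_atTop (M / ε), eventually_ge_atTop T] with x hx hTx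
      have h1 : M ≤ ε * x := by rwa [div_le_iff₀' hεpos] at hx
      have h2 : 0 ≤ C * x ^ p := mul_nonneg hC (Real.rpow_nonneg (hT.trans_le hTx).le _)
      linarith [hM x hTx]
    · intro x hx hneg
      have hx0 : 0 < x := hT.trans_le hx
      have hsplit : x ^ p = x ^ (p - 1 - 1) * x ^ 2 := by
        rw [← Real.rpow_natCast, ← Real.rpow_add hx0]; congr 1; push_cast; ring
      have hq : 0 < x ^ (p - 1 - 1) := Real.rpow_pos_of_pos hx0 _
      have h1 := abs_le.1 (hh x hx)
      have h2 : L * (C * x ^ p) < L * w x := by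
        have := mul_pos hεpos hx0
        exact mul_lt_mul_of_pos_left (by linarith) hL
      have h3 : 2 * K * x ^ p ≤ L * C * x ^ p :=
        mul_le_mul_of_nonneg_right hKC (Real.rpow_nonneg hx0.le _)
      have h4 : 2 * (p * (p - 1)) ≤ L * x ^ 2 := by
        have : T ^ 2 ≤ x ^ 2 := by gcongr
        have := mul_le_mul_of_nonneg_left this hL.le
        linarith [le_abs_self (p * (p - 1))]
      have h5 : C * x ^ (p - 1 - 1) * (2 * (p * (p - 1))) ≤ C * x ^ (p - 1 - 1) * (L * x ^ 2) :=
        mul_le_mul_of_nonneg_left h4 (by positivity)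
      have h6 : C * x ^ (p - 1 - 1) * (L * x ^ 2) = L * C * x ^ p := by rw [hsplit]; ring
      rw [hode x hx]
      nlinarith
  have : ε * t = δ := by rw [hε]; field_simp
  linarith

/-- Bounded solutions of `w'' = L w - h` with `L > 0` and `h = O(t ^ p)` are `O(t ^ p)`. -/
theorem isBigO_rpow_of_deriv2_eq {w w' w'' h : ℝ → ℝ} {T₀ L K M p : ℝ} (hL : 0 < L)
    (hw : ∀ t, T₀ ≤ t → HasDerivAt w (w' t) t) (hw' : ∀ t, T₀ ≤ t → HasDerivAt w' (w'' t) t)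
    (hode : ∀ t, T₀ ≤ t → w'' t = L * w t - h t) (hh : ∀ t, T₀ ≤ t → |h t| ≤ K * t ^ p)
    (hM : ∀ t, T₀ ≤ t → |w t| ≤ M) : w =O[atTop] fun t => t ^ p := by
  obtain ⟨T, hTT₀, hT1, hTp⟩ : ∃ T, T₀ ≤ T ∧ 1 ≤ T ∧ 2 * |p * (p - 1)| ≤ L * T ^ 2 := by
    have h1 : Tendsto (fun T : ℝ => L * T ^ 2) atTop atTop :=
      (tendsto_pow_atTop two_ne_zero).const_mul_atTop hL
    obtain ⟨T, h⟩ := ((eventually_ge_atTop T₀).and ((eventually_ge_atTop 1).and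
      (h1.eventually_ge_atTop (2 * |p * (p - 1)|)))).exists
    exact ⟨T, h⟩
  have hT : 0 < T := by linarith
  have hTpow : 0 < T ^ p := Real.rpow_pos_of_pos hT p
  set C := max 0 (max (2 * K / L) (M / T ^ p)) with hCdef
  have hC : 0 ≤ C := le_max_left _ _
  have hKC : 2 * K ≤ L * C := by
    rw [← div_le_iff₀' hL]; exact (le_max_left _ _).trans (le_max_right _ _)
  have hMC : M ≤ C * T ^ p := by
    rw [← div_le_iff₀ hTpow]; exact (le_max_right _ _).trans (le_max_right _ _)
  refine IsBigO.of_bound C ?_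
  filter_upwards [eventually_ge_atTop T] with t ht
  rw [Real.norm_eq_abs, Real.norm_of_nonneg (Real.rpow_nonneg (hT.trans_le ht).le _), abs_le']
  constructor
  · exact le_rpow_of_deriv2_eq hL hT (fun t ht => hw t (hTT₀.trans ht))
      (fun t ht => hw' t (hTT₀.trans ht)) (fun t ht => hode t (hTT₀.trans ht))
      (fun t ht => hh t (hTT₀.trans ht)) (fun t ht => (abs_le.1 (hM t (hTT₀.trans ht))).2)
      hC hTp hKC hMC ht
  -- The equation is linear, so the lower bound is the upper bound for `-w`.
  · exact le_rpow_of_deriv2_eq (w := fun t => -w t) (h := fun t => -h t) hL hT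
      (fun t ht => (hw t (hTT₀.trans ht)).neg) (fun t ht => (hw' t (hTT₀.trans ht)).neg)
      (fun t ht => by rw [hode t (hTT₀.trans ht)]; ring)
      (fun t ht => by rw [abs_neg]; exact hh t (hTT₀.trans ht))
      (fun t ht => neg_le.1 (abs_le.1 (hM t (hTT₀.trans ht))).1)
      hC hTp hKC hMC ht

/-- A bounded continuous solution of the integrated equation `r'' = L r - c a (a - 1) t ^ (a - 2)`
is asymptotic to `c a (a - 1) / L * t ^ (a - 2)`, up to `O(t ^ (a - 3))`. -/
theorem isBigO_sub_rpow_of_integral_eq {r : ℝ → ℝ} {L c a M : ℝ} (hL : 0 < L)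
    (hr : Continuous r) (hM : ∀ t, |r t| ≤ M) (ha : a < 2)
    (heq : ∀ t, 0 < t → r t = r 0 + L * (∫ u in (0 : ℝ)..t, (t - u) * r u) - c * t ^ a) :
    (fun t => r t - c * a * (a - 1) / L * t ^ (a - 2)) =O[atTop] fun t => t ^ (a - 3) := by
  set q := c * a * (a - 1) / L with hq
  have hI1 : ∀ t, HasDerivAt (fun t => ∫ u in (0 : ℝ)..t, r u) (r t) t := fun t =>
    intervalIntegral.integral_hasDerivAt_right (hr.intervalIntegrable _ _)
      (hr.stronglyMeasurableAtFilter _ _) hr.continuousAt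
  have hur : Continuous fun u => u * r u := by fun_prop
  have hI2 : ∀ t, HasDerivAt (fun t => ∫ u in (0 : ℝ)..t, u * r u) (t * r t) t := fun t =>
    intervalIntegral.integral_hasDerivAt_right (hur.intervalIntegrable _ _)
      (hur.stronglyMeasurableAtFilter _ _) hur.continuousAt
  -- The splitting takes `t` out of the integrand, so that the fundamental theorem of calculus
  -- applies.
  have hG : ∀ t, (∫ u in (0 : ℝ)..t, (t - u) * r u)
      = t * (∫ u in (0 : ℝ)..t, r u) - ∫ u in (0 : ℝ)..t, u * r u := fun t => by
    rw [← intervalIntegral.integral_const_mul, ← intervalIntegral.integral_sub]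
    · simp only [sub_mul]
    · exact (hr.const_mul t).intervalIntegrable _ _
    · exact hur.intervalIntegrable _ _
  have hr1 : ∀ t, 0 < t →
      HasDerivAt r (L * (∫ u in (0 : ℝ)..t, r u) - c * (a * t ^ (a - 1))) t := by
    intro t ht
    have h1 : HasDerivAt (fun t => r 0 + L * (t * (∫ u in (0 : ℝ)..t, r u)
        - ∫ u in (0 : ℝ)..t, u * r u) - c * t ^ a)
        (L * (1 * (∫ u in (0 : ℝ)..t, r u) + t * r t - t * r t) - c * (a * t ^ (a - 1))) t :=
      (((((hasDerivAt_id t).mul (hI1 t)).sub (hI2 t)).const_mul L).const_add (r 0)).sub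
        ((Real.hasDerivAt_rpow_const (Or.inl ht.ne')).const_mul c)
    have h2 := h1.congr_of_eventuallyEq (f₁ := r) (by
      filter_upwards [Ioi_mem_nhds ht] with x hx
      rw [heq x hx, hG x])
    exact h2.congr_deriv (by ring)
  refine isBigO_rpow_of_deriv2_eq (T₀ := 1) (L := L) (K := |q * (a - 2) * (a - 3)|)
    (M := M + |q|) (h := fun t => q * ((a - 2) * ((a - 2 - 1) * t ^ (a - 2 - 1 - 1))))
    (w' := fun t => (L * (∫ u in (0 : ℝ)..t, r u) - c * (a * t ^ (a - 1)))
      - q * ((a - 2) * t ^ (a - 2 - 1)))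
    (w'' := fun t => (L * r t - c * (a * ((a - 1) * t ^ (a - 1 - 1))))
      - q * ((a - 2) * ((a - 2 - 1) * t ^ (a - 2 - 1 - 1)))) hL ?_ ?_ ?_ ?_ ?_
  · intro t ht
    exact (hr1 t (by linarith)).sub
      ((Real.hasDerivAt_rpow_const (Or.inl (by linarith))).const_mul q)
  · intro t ht
    have ht0 : t ≠ 0 := by linarith
    exact (((hI1 t).const_mul L).sub
      (((Real.hasDerivAt_rpow_const (Or.inl ht0)).const_mul a).const_mul c)).sub
      (((Real.hasDerivAt_rpow_const (Or.inl ht0)).const_mul (a - 2)).const_mul q)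
  -- The value of `q` makes `L q t^(a-2)` cancel the forcing `c a (a-1) t^(a-2)`.
  · intro t ht
    have : a - 1 - 1 = a - 2 := by ring
    rw [this, mul_sub, hq]
    field_simp
  · intro t ht
    have h1 : t ^ (a - 2 - 1 - 1) ≤ t ^ (a - 3) :=
      Real.rpow_le_rpow_of_exponent_le ht (by linarith)
    have h2 : (a - 2 - 1) = a - 3 := by ring
    have h3 : 0 ≤ t ^ (a - 2 - 1 - 1) := Real.rpow_nonneg (by linarith) _
    calc |q * ((a - 2) * ((a - 2 - 1) * t ^ (a - 2 - 1 - 1)))|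
        = |q * (a - 2) * (a - 2 - 1)| * t ^ (a - 2 - 1 - 1) := by
          rw [← mul_assoc, ← mul_assoc, abs_mul, abs_of_nonneg h3]
      _ ≤ |q * (a - 2) * (a - 3)| * t ^ (a - 3) := by
          rw [h2] at h1 ⊢
          exact mul_le_mul_of_nonneg_left h1 (abs_nonneg _)
  · intro t ht
    have h1 : |t ^ (a - 2)| ≤ 1 := by
      rw [abs_of_nonneg (Real.rpow_nonneg (by linarith) _)]
      exact Real.rpow_le_one_of_one_le_of_nonpos ht (by linarith)
    calc |r t - q * t ^ (a - 2)| ≤ |r t| + |q * t ^ (a - 2)| := abs_sub _ _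
      _ ≤ M + |q| * 1 := by rw [abs_mul]; gcongr; exact hM t
      _ = M + |q| := by ring

/-! ### Binomial expansions, Riemann sums and differences of powers -/

theorem isBigO_one_add_rpow_sub_one (p : ℝ) :
    (fun y : ℝ => (1 + y) ^ p - 1) =O[nhds 0] fun y => y := by
  have h := (Real.one_add_rpow_hasFPowerSeriesAt_zero (a := p)).isBigO_sub_partialSum_pow 1
  refine (IsBigO.congr_left h fun y => ?_).trans (IsBigO.of_bound 1 (.of_forall fun y => by simp))
  simp [FormalMultilinearSeries.partialSum, binomialSeries_apply,
    -FormalMultilinearSeries.apply_eq_prod_smul_coeff]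

theorem isBigO_one_add_rpow_sub_quadratic (p : ℝ) :
    (fun y : ℝ => (1 + y) ^ p - 1 - p * y - p * (p - 1) / 2 * y ^ 2) =O[nhds 0] fun y => y ^ 3 := by
  have h := (Real.one_add_rpow_hasFPowerSeriesAt_zero (a := p)).isBigO_sub_partialSum_pow 3
  have h2 : Ring.choose p 2 = p * (p - 1) / 2 := by
    rw [Ring.choose_eq_smul]
    simp [descPochhammer_succ_right, Polynomial.smeval_mul, Polynomial.smeval_sub]
    ring
  refine (IsBigO.congr_left h fun y => ?_).trans (IsBigO.of_bound 1 (.of_forall fun y => by simp))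
  simp [FormalMultilinearSeries.partialSum, Finset.sum_range_succ, binomialSeries_apply, h2,
    -FormalMultilinearSeries.apply_eq_prod_smul_coeff]
  ring

/-- Riemann sums of a continuous function converge to the integral. -/
theorem tendsto_riemannSum {f : ℝ → ℝ} (hf : Continuous f) {t : ℝ} (ht : 0 ≤ t) :
    Tendsto (fun m : ℕ => t / m * ∑ k ∈ Finset.range m, f (k * (t / m))) atTop
      (nhds (∫ u in (0 : ℝ)..t, f u)) := by
  rw [Metric.tendsto_atTop]
  intro ε hε
  have huc := isCompact_Icc.uniformContinuousOn_of_continuous (s := Set.Icc 0 t) hf.continuousOn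
  rw [Metric.uniformContinuousOn_iff_le] at huc
  -- Dividing by `t + 1` allows `t = 0` and keeps the total error `ε t / (t + 1)` strictly below
  -- `ε`.
  obtain ⟨δ, hδ, hfδ⟩ := huc (ε / (t + 1)) (by positivity)
  obtain ⟨N, hN⟩ := exists_nat_gt (t / δ)
  refine ⟨N + 1, fun m hm => ?_⟩
  have hm0 : 0 < (m : ℝ) := by exact_mod_cast (by omega : 0 < m)
  have hstep : t / m ≤ δ := by
    rw [div_le_iff₀ hm0, mul_comm, ← div_le_iff₀ hδ]
    exact hN.le.trans (by exact_mod_cast (by omega : N ≤ m))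
  have hh : 0 ≤ t / m := by positivity
  have hsum : ∑ k ∈ Finset.range m, ∫ u in ((k : ℕ) * (t / m))..((k + 1 : ℕ) * (t / m)), f u
      = ∫ u in (0 : ℝ)..t, f u := by
    rw [intervalIntegral.sum_integral_adjacent_intervals (a := fun k : ℕ => (k : ℝ) * (t / m))
      fun k _ => hf.intervalIntegrable _ _]
    congr 1
    · simp
    · field_simp
  have hterm : ∀ k ∈ Finset.range m, ‖t / m * f (k * (t / m))
      - ∫ u in ((k : ℕ) * (t / m))..((k + 1 : ℕ) * (t / m)), f u‖ ≤ ε / (t + 1) * (t / m) := by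
    intro k hk
    have hkm : (k : ℝ) + 1 ≤ m := by exact_mod_cast Finset.mem_range.1 hk
    have hle : (k : ℝ) * (t / m) ≤ (k + 1 : ℕ) * (t / m) := by push_cast; gcongr; linarith
    have htop : ((k + 1 : ℕ) : ℝ) * (t / m) ≤ t := by
      calc ((k + 1 : ℕ) : ℝ) * (t / m) ≤ m * (t / m) := by push_cast; gcongr
        _ = t := by field_simp
    have hk0 : 0 ≤ (k : ℝ) * (t / m) := by positivity
    have hlen : ((k + 1 : ℕ) : ℝ) * (t / m) - k * (t / m) = t / m := by push_cast; ring
    have hconst : t / m * f (k * (t / m))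
        = ∫ _ in ((k : ℕ) * (t / m))..((k + 1 : ℕ) * (t / m)), f (k * (t / m)) := by
      rw [intervalIntegral.integral_const, hlen, smul_eq_mul]
    rw [hconst, ← intervalIntegral.integral_sub (by simp) (hf.intervalIntegrable _ _)]
    have := intervalIntegral.norm_integral_le_of_norm_le_const
      (a := (k : ℝ) * (t / m)) (b := (k + 1 : ℕ) * (t / m)) (C := ε / (t + 1))
      (f := fun u => f (k * (t / m)) - f u) ?_
    · rwa [hlen, abs_of_nonneg hh] at this
    · intro u hu
      rw [Set.uIoc_of_le hle] at hu
      refine hfδ _ ⟨hk0, hle.trans htop⟩ _ ⟨hk0.trans hu.1.le, hu.2.trans htop⟩ ?_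
      rw [Real.dist_eq, abs_sub_comm, abs_of_nonneg (by linarith [hu.1])]
      linarith [hu.2]
  rw [← hsum, Finset.mul_sum, dist_eq_norm, ← Finset.sum_sub_distrib]
  calc _ ≤ ∑ k ∈ Finset.range m, ε / (t + 1) * (t / m) := norm_sum_le_of_le _ hterm
    _ = ε * (t / (t + 1)) := by
      rw [Finset.sum_const, Finset.card_range, nsmul_eq_mul]; field_simp
    _ < ε * 1 := by
      gcongr
      rw [div_lt_one (by linarith)]; linarith
    _ = ε := mul_one ε

theorem isBigO_rpow_add_sub_rpow (p a : ℝ) :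
    (fun x : ℝ => (x + a) ^ p - x ^ p) =O[atTop] fun x => x ^ (p - 1) := by
  have hy : Tendsto (fun x : ℝ => a * x⁻¹) atTop (nhds 0) := by
    simpa using tendsto_inv_atTop_zero.const_mul a
  have h1 := (isBigO_one_add_rpow_sub_one p).comp_tendsto hy
  have h2 := (isBigO_refl (fun x : ℝ => x ^ p) atTop).mul
    (h1.trans (isBigO_const_mul_self a (fun x : ℝ => x⁻¹) atTop))
  refine h2.congr' ?_ ?_
  · filter_upwards [eventually_gt_atTop 0, eventually_ge_atTop (-a)] with x hx hxa
    have : x + a = x * (1 + a * x⁻¹) := by field_simp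
    have h3 : 0 ≤ 1 + a * x⁻¹ := by
      have : 1 + a * x⁻¹ = (x + a) / x := by field_simp
      rw [this]; exact div_nonneg (by linarith) hx.le
    rw [this, Real.mul_rpow hx.le h3]
    simp; ring
  · filter_upwards [eventually_gt_atTop 0] with x hx
    rw [Real.rpow_sub_one hx.ne', div_eq_mul_inv]

theorem isBigO_rpow_add (p a : ℝ) :
    (fun x : ℝ => (x + a) ^ p) =O[atTop] fun x => x ^ p := by
  have h : (fun x : ℝ => x ^ (p - 1)) =O[atTop] fun x => x ^ p := by
    refine IsBigO.of_bound 1 ?_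
    filter_upwards [eventually_ge_atTop 1] with x hx
    rw [one_mul, Real.norm_of_nonneg (by positivity), Real.norm_of_nonneg (by positivity)]
    exact Real.rpow_le_rpow_of_exponent_le hx (by linarith)
  exact (((isBigO_rpow_add_sub_rpow p a).trans h).add (isBigO_refl _ _)).congr_left
    fun x => by ring

/-- Factor out `x^p` and add the quadratic expansions at `1/x` and `-1/x`: the linear terms cancel
and the remainder is cubic. -/
theorem isBigO_second_difference_rpow (p : ℝ) :
    (fun x : ℝ => ((x + 1) ^ p + (x - 1) ^ p - 2 * x ^ p) / 2 - p * (p - 1) / 2 * x ^ (p - 2))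
      =O[atTop] fun x => x ^ (p - 3) := by
  have hy : Tendsto (fun x : ℝ => x⁻¹) atTop (nhds 0) := tendsto_inv_atTop_zero
  have hy' : Tendsto (fun x : ℝ => -x⁻¹) atTop (nhds 0) := by simpa using hy.neg
  have h1 := (isBigO_one_add_rpow_sub_quadratic p).comp_tendsto hy
  have h2 := (isBigO_one_add_rpow_sub_quadratic p).comp_tendsto hy'
  have h2' := h2.trans (IsBigO.of_bound 1 (.of_forall fun x => by simp) :
    _ =O[atTop] ((fun y : ℝ => y ^ 3) ∘ fun x : ℝ => x⁻¹))
  have h3 := (isBigO_refl (fun x : ℝ => x ^ p) atTop).mul ((h1.add h2').const_mul_left (1 / 2))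
  refine h3.congr' ?_ ?_
  · filter_upwards [eventually_gt_atTop 1] with x hx
    have hx0 : 0 < x := by linarith
    have e1 : x + 1 = x * (1 + x⁻¹) := by field_simp
    have e2 : x - 1 = x * (1 + -x⁻¹) := by field_simp; ring
    have hinv : x⁻¹ ≤ 1 := inv_le_one_of_one_le₀ hx.le
    have e3 : x ^ (p - 2) = x ^ p * x⁻¹ ^ 2 := by
      rw [Real.rpow_sub hx0, Real.rpow_two, inv_pow, div_eq_mul_inv]
    rw [e1, e2, e3, Real.mul_rpow hx0.le (by positivity), Real.mul_rpow hx0.le (by linarith)]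
    simp only [Function.comp_apply]
    ring
  · filter_upwards [eventually_gt_atTop 0] with x hx
    have : x ^ (p - 3) = x ^ p * x⁻¹ ^ 3 := by
      rw [Real.rpow_sub hx, show (3 : ℝ) = ((3 : ℕ) : ℝ) by norm_num, Real.rpow_natCast, inv_pow,
        div_eq_mul_inv]
    simp [this]

/-! ### Second-order theory of stationary sequences -/

section StationarySequences

variable {Ω : Type*} [MeasurableSpace Ω] {P : Measure Ω}
  {X : ℕ → Ω → ℝ} {c : ℕ → ℝ}

theorem HasAutocovariance.covariance_of_le (hc : HasAutocovariance X c P) {i j : ℕ} (h : i ≤ j) :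
    cov[X i, X j; P] = c (j - i) := by
  rw [← hc i (j - i), Nat.add_sub_cancel' h]

/-- Subtraction is truncated, so one summand is zero and the argument is the distance of `i` and
`j`. -/
theorem HasAutocovariance.covariance_eq (hc : HasAutocovariance X c P) (i j : ℕ) :
    cov[X i, X j; P] = c ((i - j) + (j - i)) := by
  rcases le_total i j with h | h
  · rw [hc.covariance_of_le h, Nat.sub_eq_zero_of_le h, zero_add]
  · rw [covariance_comm, hc.covariance_of_le h, Nat.sub_eq_zero_of_le h, add_zero]

theorem HasAutocovariance.eq_autocov (hc : HasAutocovariance X c P) : autocov X P = c := by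
  funext k
  have := hc 0 k
  rwa [zero_add] at this

variable [IsProbabilityMeasure P]

theorem HasAutocovariance.variance_sub (hc : HasAutocovariance X c P)
    (hX : ∀ k, MemLp (X k) 2 P) (n k : ℕ) :
    Var[fun ω => X (n + k) ω - X k ω; P] = 2 * (c 0 - c n) := by
  rw [variance_fun_sub (hX _) (hX _), ← covariance_self (hX _).aestronglyMeasurable.aemeasurable,
    ← covariance_self (hX _).aestronglyMeasurable.aemeasurable, hc.covariance_eq, hc.covariance_eq,
    hc.covariance_eq]
  simp
  ring

theorem HasAutocovariance.variance_sum (hc : HasAutocovariance X c P)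
    (hX : ∀ k, MemLp (X k) 2 P) (m : ℕ) :
    Var[fun ω => ∑ k ∈ Finset.range m, X k ω; P]
      = 2 * ∑ k ∈ Finset.range m, ((m : ℝ) - k) * c k - m * c 0 := by
  induction m with
  | zero =>
    simp only [Finset.range_zero, Finset.sum_empty, Nat.cast_zero, zero_mul, mul_zero, sub_zero]
    exact variance_zero P
  | succ m ih =>
    have hS : MemLp (fun ω => ∑ k ∈ Finset.range m, X k ω) 2 P :=
      memLp_finsetSum _ fun k _ => hX k
    have hcov : cov[fun ω => ∑ k ∈ Finset.range m, X k ω, X m; P]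
        = ∑ k ∈ Finset.range m, c (k + 1) := by
      rw [covariance_fun_sum_left' (fun k _ => hX k) (hX m),
        ← Finset.sum_range_reflect (fun k => c (k + 1))]
      refine Finset.sum_congr rfl fun k hk => ?_
      have := Finset.mem_range.1 hk
      rw [hc.covariance_of_le this.le]
      congr 1
      omega
    simp_rw [Finset.sum_range_succ _ m]
    rw [variance_fun_add hS (hX m), ih, hcov,
      ← covariance_self (hX _).aestronglyMeasurable.aemeasurable, hc.covariance_of_le le_rfl]
    have h1 : ∑ k ∈ Finset.range m, c (k + 1) = ∑ k ∈ Finset.range m, c k + c m - c 0 := by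
      rw [← Finset.sum_range_succ, Finset.sum_range_succ']; ring
    have h2 : ∑ k ∈ Finset.range m, (((m + 1 : ℕ) : ℝ) - k) * c k
        = ∑ k ∈ Finset.range m, ((m : ℝ) - k) * c k + ∑ k ∈ Finset.range m, c k := by
      rw [← Finset.sum_add_distrib]
      exact Finset.sum_congr rfl fun k _ => by push_cast; ring
    rw [h1, h2]
    push_cast
    simp
    ring

/-- Discrete form of the variance of `V(t) - V(0) + lam ∫ V`. The cross covariance telescopes to the
boundary term `c m - c 0`, which is negligible once `μ` is of the order of the mesh. -/
theorem HasAutocovariance.variance_sub_add_sum (hc : HasAutocovariance X c P)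
    (hX : ∀ k, MemLp (X k) 2 P) (μ : ℝ) (m : ℕ) :
    Var[fun ω => (X m ω - X 0 ω) + μ * ∑ k ∈ Finset.range m, X k ω; P]
      = 2 * (c 0 - c m) + 2 * μ * (c m - c 0)
        + μ ^ 2 * (2 * ∑ k ∈ Finset.range m, ((m : ℝ) - k) * c k - m * c 0) := by
  have hS : MemLp (fun ω => ∑ k ∈ Finset.range m, X k ω) 2 P :=
    memLp_finsetSum _ fun k _ => hX k
  have hA : MemLp (fun ω => X m ω - X 0 ω) 2 P := (hX m).sub (hX 0)
  have hcov : cov[fun ω => X m ω - X 0 ω, fun ω => ∑ k ∈ Finset.range m, X k ω; P] = c m - c 0 := by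
    rw [covariance_fun_sub_left (hX m) (hX 0) hS, covariance_fun_sum_right' (fun k _ => hX k) (hX m),
      covariance_fun_sum_right' (fun k _ => hX k) (hX 0)]
    have h1 : ∑ k ∈ Finset.range m, cov[X m, X k; P] = ∑ k ∈ Finset.range m, c (k + 1) := by
      rw [← Finset.sum_range_reflect (fun k => c (k + 1))]
      refine Finset.sum_congr rfl fun k hk => ?_
      have := Finset.mem_range.1 hk
      rw [covariance_comm, hc.covariance_of_le this.le]
      congr 1
      omega
    have h2 : ∑ k ∈ Finset.range m, cov[X 0, X k; P] = ∑ k ∈ Finset.range m, c k :=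
      Finset.sum_congr rfl fun k hk => by rw [hc.covariance_of_le (Nat.zero_le k), Nat.sub_zero]
    rw [h1, h2, ← Finset.sum_sub_distrib, Finset.sum_range_sub]
  have hV := hc.variance_sub hX m 0
  rw [add_zero] at hV
  rw [variance_fun_add hA (hS.const_mul μ), covariance_const_mul_right, hcov, hV,
    variance_const_mul, hc.variance_sum hX]
  ring

/-- Cauchy–Schwarz: the variance of `U + x W` is a nonnegative quadratic in `x`. -/
theorem sq_covariance_le_variance_mul_variance {U W : Ω → ℝ} (hU : MemLp U 2 P)
    (hW : MemLp W 2 P) : cov[U, W; P] ^ 2 ≤ Var[U; P] * Var[W; P] := by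
  have h : ∀ x : ℝ, 0 ≤ Var[W; P] * (x * x) + 2 * cov[U, W; P] * x + Var[U; P] := fun x => by
    have := variance_nonneg (fun ω => U ω + x * W ω) P
    rw [variance_fun_add hU (hW.const_mul x), covariance_const_mul_right, variance_const_mul] at this
    linarith
  have := discrim_le_zero h
  rw [discrim] at this
  linarith

theorem HasAutocovariance.abs_le (hc : HasAutocovariance X c P)
    (hX : ∀ k, MemLp (X k) 2 P) (k : ℕ) : |c k| ≤ c 0 := by
  have h := sq_covariance_le_variance_mul_variance (hX 0) (hX (0 + k))
  have h0 := variance_nonneg (X 0) P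
  rw [← covariance_self (hX _).aestronglyMeasurable.aemeasurable, hc.covariance_of_le le_rfl,
    ← covariance_self (hX _).aestronglyMeasurable.aemeasurable, hc.covariance_of_le le_rfl,
    hc 0 k] at h
  rw [← covariance_self (hX _).aestronglyMeasurable.aemeasurable, hc.covariance_of_le le_rfl] at h0
  simp only [Nat.sub_self] at h h0
  exact abs_le_of_sq_le_sq (by linarith) h0

/-- The increments of a nonzero stationary sequence whose autocovariance vanishes at infinity are
not degenerate. -/
theorem HasAutocovariance.lt_of_tendsto_zero (hc : HasAutocovariance X c P)
    (hX : ∀ k, MemLp (X k) 2 P) (h0 : c 0 ≠ 0) (hlim : Tendsto c atTop (nhds 0)) {n : ℕ}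
    (hn : 0 < n) : c n < c 0 := by
  refine lt_of_le_of_ne ((le_abs_self _).trans (hc.abs_le hX n)) fun heq => h0 ?_
  -- The increment `X (n + k) - X k` has variance zero, hence no covariance with `X 0`.
  have hstep : ∀ k, c (n + k) = c k := fun k => by
    have h := sq_covariance_le_variance_mul_variance (hX 0) ((hX (n + k)).sub (hX k))
    rw [covariance_sub_right (hX 0) (hX _) (hX _), hc.covariance_of_le (Nat.zero_le _),
      hc.covariance_of_le (Nat.zero_le _)] at h
    have h' : Var[X (n + k) - X k; P] = 0 := by
      rw [show X (n + k) - X k = fun ω => X (n + k) ω - X k ω from rfl, hc.variance_sub hX, heq]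
      ring
    rw [h', mul_zero] at h
    have := pow_eq_zero_iff two_ne_zero |>.1 (le_antisymm h (sq_nonneg _))
    simpa [sub_eq_zero] using this
  have hmul : ∀ j, c (n * j) = c 0 := fun j => by
    induction j with
    | zero => simp
    | succ j ih => rw [Nat.mul_succ, add_comm, hstep, ih]
  have h1 : Tendsto (fun j : ℕ => c (n * j)) atTop (nhds 0) :=
    hlim.comp (tendsto_id.const_mul_atTop' hn)
  simp_rw [hmul] at h1
  exact tendsto_nhds_unique tendsto_const_nhds h1

theorem HasAutocovariance.normalizedIncrement (hc : HasAutocovariance X c P)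
    (hX : ∀ k, MemLp (X k) 2 P) (n : ℕ) :
    HasAutocovariance (normalizedIncrement X P n) (fun k => incrementScale X P n ^ 2 *
      (2 * c k - c (k + n) - c ((n - k) + (k - n)))) P := by
  intro j k
  have hsub : ∀ k, MemLp (fun ω => X (n + k) ω - X k ω) 2 P := fun k => (hX _).sub (hX _)
  unfold _root_.normalizedIncrement
  rw [covariance_const_mul_left, covariance_const_mul_right,
    covariance_fun_sub_fun_sub (hX _) (hX _) (hX _) (hX _), hc.covariance_eq, hc.covariance_eq,
    hc.covariance_eq, hc.covariance_eq]
  have e1 : n + j - (n + (j + k)) + (n + (j + k) - (n + j)) = k := by omega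
  have e2 : n + j - (j + k) + (j + k - (n + j)) = (n - k) + (k - n) := by omega
  have e3 : j - (n + (j + k)) + (n + (j + k) - j) = k + n := by omega
  have e4 : j - (j + k) + (j + k - j) = k := by omega
  rw [e1, e2, e3, e4]
  ring

theorem HasAutocovariance.variance_normalizedIncrement (hc : HasAutocovariance X c P)
    (hX : ∀ k, MemLp (X k) 2 P) {n : ℕ} (h : c n < c 0) (k : ℕ) :
    Var[_root_.normalizedIncrement X P n k; P] = 1 := by
  have hpos : 0 < 2 * (c 0 - c n) := by linarith
  have h0 := hc.variance_sub hX n 0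
  rw [add_zero] at h0
  unfold _root_.normalizedIncrement incrementScale
  rw [variance_const_mul, hc.variance_sub hX n k, h0, inv_pow, Real.sq_sqrt hpos.le,
    inv_mul_cancel₀ hpos.ne']

end StationarySequences

/-! ### Differences and summability of power-law sequences -/

section Asymptotics

variable {c : ℕ → ℝ} {A α : ℝ}

theorem tendsto_zero_of_isBigO_sub_rpow (hα : α < 2)
    (hc : (fun k : ℕ => c k - A * (k : ℝ) ^ (α - 2)) =O[atTop] fun k : ℕ => (k : ℝ) ^ (α - 3)) :
    Tendsto c atTop (nhds 0) := by
  have hpow : ∀ p : ℝ, p < 0 → Tendsto (fun k : ℕ => (k : ℝ) ^ p) atTop (nhds 0) := fun p hp => by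
    have := (tendsto_rpow_neg_atTop (y := -p) (by linarith)).comp tendsto_natCast_atTop_atTop
    simpa [Function.comp_def] using this
  have h1 := (hc.trans_tendsto (hpow _ (by linarith))).add
    ((hpow (α - 2) (by linarith)).const_mul A)
  simpa using h1

/-- First differences suffice: each shift by `±n` changes `k^(α-2)` by `O(k^(α-3))`, already the
size of the error in `hc`. -/
theorem isBigO_second_difference (n : ℕ)
    (hc : (fun k : ℕ => c k - A * (k : ℝ) ^ (α - 2)) =O[atTop] fun k : ℕ => (k : ℝ) ^ (α - 3)) :
    (fun k : ℕ => 2 * c k - c (k + n) - c ((n - k) + (k - n))) =O[atTop]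
      fun k : ℕ => (k : ℝ) ^ (α - 3) := by
  have hnat := tendsto_natCast_atTop_atTop (R := ℝ)
  have hadd : Tendsto (fun k : ℕ => k + n) atTop atTop := tendsto_add_atTop_nat n
  have hsub : Tendsto (fun k : ℕ => k - n) atTop atTop := tendsto_sub_atTop_nat n
  have e : α - 2 - 1 = α - 3 := by ring
  have hp := (isBigO_rpow_add_sub_rpow (α - 2) n).comp_tendsto hnat
  have hm := (isBigO_rpow_add_sub_rpow (α - 2) (-n)).comp_tendsto hnat
  rw [e] at hp hm
  have hcp := (hc.comp_tendsto hadd).trans (((isBigO_rpow_add (α - 3) n).comp_tendsto hnat).congr_left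
    fun k => by simp)
  have hcm := (hc.comp_tendsto hsub).trans (((isBigO_rpow_add (α - 3) (-n)).comp_tendsto hnat).congr'
    (by filter_upwards [eventually_ge_atTop n] with k hk
        simp [Nat.cast_sub hk, sub_eq_add_neg]) EventuallyEq.rfl)
  refine ((((hc.const_mul_left 2).sub hcp).sub hcm).sub
    ((hp.add hm).const_mul_left A)).congr' ?_ EventuallyEq.rfl
  filter_upwards [eventually_ge_atTop n] with k hk
  simp only [Function.comp_apply, Nat.cast_sub hk, Nat.cast_add, Nat.sub_eq_zero_of_le hk, zero_add,
    sub_eq_add_neg]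
  ring

theorem summable_abs_of_isBigO_rpow {g : ℕ → ℝ} {p : ℝ} (hp : p < -1)
    (hg : g =O[atTop] fun k : ℕ => (k : ℝ) ^ p) : Summable fun k => |g k| :=
  (summable_of_isBigO_nat (Real.summable_nat_rpow.2 hp) hg).abs

end Asymptotics

/-! ### Gaussian variables and convergence of variances -/

section Gaussian

variable {Ω : Type*} [MeasurableSpace Ω] {P : Measure Ω}

theorem integral_cos_of_hasGaussianLaw {X : Ω → ℝ} (hX : HasGaussianLaw X P)
    (h0 : ∫ ω, X ω ∂P = 0) : ∫ ω, Real.cos (X ω) ∂P = Real.exp (-Var[X; P] / 2) := by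
  have : IsProbabilityMeasure P := hX.isProbabilityMeasure
  have h1 := charFun_gaussianReal (μ := P[X]) (v := Var[X; P].toNNReal) 1
  rw [← hX.map_eq_gaussianReal, charFun_apply_real, integral_map hX.aemeasurable (by fun_prop),
    h0, Real.coe_toNNReal _ (variance_nonneg X P)] at h1
  have hint : Integrable (fun ω => Complex.exp ((X ω : ℂ) * Complex.I)) P := by
    refine Integrable.of_bound (C := 1) ?_ (.of_forall fun ω => ?_)
    · have := hX.aemeasurable
      exact AEMeasurable.aestronglyMeasurable (by fun_prop)
    · rw [Complex.norm_exp_ofReal_mul_I]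
  have h2 := congrArg Complex.re h1
  simp only [Complex.ofReal_one, one_mul] at h2
  have h3 := integral_re (𝕜 := ℂ) hint
  simp only [RCLike.re_eq_complex_re] at h3
  rw [← h3] at h2
  simp only [Complex.exp_ofReal_mul_I_re] at h2
  rw [h2]
  have : ((0 : ℝ) : ℂ) * Complex.I - (Var[X; P] : ℂ) * 1 ^ 2 / 2 = ((-Var[X; P] / 2 : ℝ) : ℂ) := by
    push_cast; ring
  rw [this, Complex.exp_ofReal_re]

/-- Almost sure convergence of centered Gaussian variables implies convergence of variances. -/
theorem tendsto_variance_of_tendsto_ae {ι : Type*} {l : Filter ι} [l.IsCountablyGenerated]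
    {X : ι → Ω → ℝ} {Z : Ω → ℝ} (hX : ∀ i, HasGaussianLaw (X i) P) (hZ : HasGaussianLaw Z P)
    (hX0 : ∀ i, ∫ ω, X i ω ∂P = 0) (hZ0 : ∫ ω, Z ω ∂P = 0)
    (hlim : ∀ᵐ ω ∂P, Tendsto (fun i => X i ω) l (nhds (Z ω))) :
    Tendsto (fun i => Var[X i; P]) l (nhds Var[Z; P]) := by
  have : IsProbabilityMeasure P := hZ.isProbabilityMeasure
  -- The cosine is bounded, so dominated convergence needs no moment bound; the variance is then
  -- read off as `-2 log E cos`.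
  have h1 : Tendsto (fun i => ∫ ω, Real.cos (X i ω) ∂P) l (nhds (∫ ω, Real.cos (Z ω) ∂P)) := by
    refine tendsto_integral_filter_of_dominated_convergence (fun _ => 1) (.of_forall fun i => ?_)
      (.of_forall fun i => .of_forall fun ω => Real.abs_cos_le_one _) (integrable_const _) ?_
    · exact (Real.measurable_cos.comp_aemeasurable (hX i).aemeasurable).aestronglyMeasurable
    · filter_upwards [hlim] with ω hω using (Real.continuous_cos.tendsto _).comp hω
  rw [integral_cos_of_hasGaussianLaw hZ hZ0] at h1
  simp_rw [fun i => integral_cos_of_hasGaussianLaw (hX i) (hX0 i)] at h1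
  have h2 := (((Real.continuousAt_log (Real.exp_pos _).ne').tendsto.comp h1).const_mul (-2))
  simp only [Function.comp_def, Real.log_exp] at h2
  have e : ∀ x : ℝ, -2 * (-x / 2) = x := fun x => by ring
  simpa only [e] using h2

theorem ProbabilityTheory.IsGaussianProcess.hasGaussianLaw_linearCombination {T : Type*}
    {V : T → Ω → ℝ} (hV : IsGaussianProcess V P) (τ : ℕ → T) (c : ℕ → ℝ) (N : ℕ) :
    HasGaussianLaw (fun ω => ∑ k ∈ Finset.range N, c k * V (τ k) ω) P :=
  ((hV.comp_right τ).smul c).hasGaussianLaw_fun_sum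

theorem covariance_eq_integral_mul [IsProbabilityMeasure P] {X Z : Ω → ℝ} (hX : MemLp X 2 P)
    (hZ : MemLp Z 2 P) (h0 : ∫ ω, X ω ∂P = 0) : cov[X, Z; P] = ∫ ω, X ω * Z ω ∂P := by
  rw [covariance_eq_sub hX hZ, h0, zero_mul, sub_zero]; rfl

end Gaussian

/-! ### Fractional Brownian motion and fractional Gaussian noise -/

section FractionalBrownianMotion

variable {Ω : Type*} [MeasurableSpace Ω] {P : Measure Ω} {B : ℝ → Ω → ℝ} {H : ℝ}

theorem IsFractionalBrownianMotion.cov_eq [IsProbabilityMeasure P]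
    (hB : IsFractionalBrownianMotion B H P) (s t : ℝ) : cov[B s, B t; P] =
      (|s| ^ (2 * H) + |t| ^ (2 * H) - |s - t| ^ (2 * H)) / 2 := by
  rw [covariance_eq_integral_mul (hB.gaussian.hasGaussianLaw_eval s).memLp_two
    (hB.gaussian.hasGaussianLaw_eval t).memLp_two (hB.centered s), hB.covariance]

theorem IsFractionalBrownianMotion.memLp_two (hB : IsFractionalBrownianMotion B H P) (t : ℝ) :
    MemLp (B t) 2 P := (hB.gaussian.hasGaussianLaw_eval t).memLp_two

theorem IsFractionalBrownianMotion.variance_sub [IsProbabilityMeasure P]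
    (hB : IsFractionalBrownianMotion B H P) (hH : 0 < H) {t : ℝ} (ht : 0 ≤ t) :
    Var[fun ω => B t ω - B 0 ω; P] = t ^ (2 * H) := by
  have hH' : 2 * H ≠ 0 := by positivity
  rw [variance_fun_sub (hB.memLp_two _) (hB.memLp_two _),
    ← covariance_self (hB.memLp_two _).aestronglyMeasurable.aemeasurable,
    ← covariance_self (hB.memLp_two _).aestronglyMeasurable.aemeasurable,
    hB.cov_eq, hB.cov_eq, hB.cov_eq]
  simp only [abs_zero, sub_self, sub_zero, Real.zero_rpow hH', abs_of_nonneg ht]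
  ring

variable {Y : ℕ → Ω → ℝ}

theorem IsFractionalGaussianNoise.memLp_two (hY : IsFractionalGaussianNoise Y H P) (k : ℕ) :
    MemLp (Y k) 2 P := by
  obtain ⟨B, hB, hYB⟩ := hY
  have : Y k = fun ω => B ((k : ℝ) + 1) ω - B k ω := funext (hYB k)
  rw [this]
  exact (hB.memLp_two _).sub (hB.memLp_two _)

theorem IsFractionalGaussianNoise.hasAutocovariance [IsProbabilityMeasure P]
    (hY : IsFractionalGaussianNoise Y H P) :
    HasAutocovariance Y (fun k => (|(k : ℝ) + 1| ^ (2 * H) + |(k : ℝ) - 1| ^ (2 * H)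
      - 2 * |(k : ℝ)| ^ (2 * H)) / 2) P := by
  obtain ⟨B, hB, hYB⟩ := hY
  intro j k
  have h : ∀ k, Y k = fun ω => B ((k : ℝ) + 1) ω - B k ω := fun k => funext (hYB k)
  rw [h, h, covariance_fun_sub_fun_sub (hB.memLp_two _) (hB.memLp_two _) (hB.memLp_two _)
    (hB.memLp_two _), hB.cov_eq, hB.cov_eq, hB.cov_eq, hB.cov_eq]
  have e1 : |(j : ℝ) + 1 - (((j + k : ℕ) : ℝ) + 1)| = |(k : ℝ)| := by
    rw [← abs_neg (k : ℝ)]; congr 1; push_cast; ring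
  have e2 : |(j : ℝ) + 1 - ((j + k : ℕ) : ℝ)| = |(k : ℝ) - 1| := by
    rw [← abs_neg ((k : ℝ) - 1)]; congr 1; push_cast; ring
  have e3 : |(j : ℝ) - (((j + k : ℕ) : ℝ) + 1)| = |(k : ℝ) + 1| := by
    rw [← abs_neg ((k : ℝ) + 1)]; congr 1; push_cast; ring
  have e4 : |(j : ℝ) - ((j + k : ℕ) : ℝ)| = |(k : ℝ)| := by
    rw [← abs_neg (k : ℝ)]; congr 1; push_cast; ring
  rw [e1, e2, e3, e4]
  ring

theorem IsFractionalGaussianNoise.isBigO [IsProbabilityMeasure P]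
    (hY : IsFractionalGaussianNoise Y H P) {α : ℝ} (hα : α = 2 * H) :
    (fun k : ℕ => autocov Y P k - α * (α - 1) / 2 * (k : ℝ) ^ (α - 2))
        =O[atTop] fun k : ℕ => (k : ℝ) ^ (α - 3) := by
  rw [hY.hasAutocovariance.eq_autocov, ← hα]
  refine ((isBigO_second_difference_rpow α).comp_tendsto tendsto_natCast_atTop_atTop).congr' ?_
    EventuallyEq.rfl
  filter_upwards [eventually_ge_atTop 1] with k hk
  have hk' : (1 : ℝ) ≤ k := by exact_mod_cast hk
  rw [abs_of_nonneg (by linarith : (0 : ℝ) ≤ k), abs_of_nonneg (by linarith : (0 : ℝ) ≤ (k : ℝ) + 1),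
    abs_of_nonneg (by linarith : (0 : ℝ) ≤ (k : ℝ) - 1)]
  rfl

theorem IsFractionalGaussianNoise.autocov_zero_ne_zero [IsProbabilityMeasure P]
    (hY : IsFractionalGaussianNoise Y H P) (hH : 0 < H) : autocov Y P 0 ≠ 0 := by
  rw [hY.hasAutocovariance.eq_autocov]
  simp [Real.zero_rpow (by positivity : 2 * H ≠ 0)]

end FractionalBrownianMotion

/-! ### The fractional Ornstein–Uhlenbeck process -/

section OrnsteinUhlenbeck

variable {Ω : Type*} [MeasurableSpace Ω] {P : Measure Ω}
  {V : ℝ≥0 → Ω → ℝ} {lam s H : ℝ}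

theorem IsFractionalOrnsteinUhlenbeck.memLp_two (hV : IsFractionalOrnsteinUhlenbeck V lam s H P)
    (t : ℝ≥0) : MemLp (V t) 2 P := (hV.gaussian.hasGaussianLaw_eval t).memLp_two

variable {Y : ℕ → Ω → ℝ}

theorem IsFractionalOUSequence.memLp_two (hY : IsFractionalOUSequence Y lam s H P) (k : ℕ) :
    MemLp (Y k) 2 P := by
  obtain ⟨V, hV, hYV⟩ := hY
  have : Y k = V k := funext (hYV k)
  rw [this]
  exact hV.memLp_two _

variable [IsProbabilityMeasure P]

theorem IsFractionalOrnsteinUhlenbeck.covariance_add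
    (hV : IsFractionalOrnsteinUhlenbeck V lam s H P) (a b h : ℝ≥0) :
    cov[V (a + h), V (b + h); P] = cov[V a, V b; P] := by
  classical
  rw [covariance_eq_integral_mul (hV.memLp_two _) (hV.memLp_two _) (hV.centered _),
    covariance_eq_integral_mul (hV.memLp_two _) (hV.memLp_two _) (hV.centered _)]
  have h1 := hV.stationary h {a, b}
  have hm : Measurable fun x : ({a, b} : Finset ℝ≥0) → ℝ => x ⟨a, by simp⟩ * x ⟨b, by simp⟩ := by
    fun_prop
  exact (h1.comp hm).integral_eq

theorem IsFractionalOrnsteinUhlenbeck.hasAutocovariance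
    (hV : IsFractionalOrnsteinUhlenbeck V lam s H P) (h : ℝ≥0) :
    HasAutocovariance (fun k : ℕ => V (k * h)) (fun k : ℕ => cov[V 0, V (k * h); P]) P := by
  intro j k
  have : ((j + k : ℕ) : ℝ≥0) * h = k * h + j * h := by push_cast; ring
  simp only [this]
  rw [← hV.covariance_add 0 (k * h) (j * h), zero_add]

/-- The autocovariance of a fractional Ornstein-Uhlenbeck process, as a function on the line which
is constant on the negative half-line. -/
noncomputable def extendedAutocov (V : ℝ≥0 → Ω → ℝ) (P : Measure Ω) (t : ℝ) : ℝ :=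
  cov[V 0, V t.toNNReal; P]

/-- Almost sure path continuity gives mean-square continuity because the increments are Gaussian;
Cauchy–Schwarz passes it to the covariance. -/
theorem IsFractionalOrnsteinUhlenbeck.continuous_extendedAutocov
    (hV : IsFractionalOrnsteinUhlenbeck V lam s H P) : Continuous (extendedAutocov V P) := by
  suffices h : Continuous fun t : ℝ≥0 => cov[V 0, V t; P] from h.comp continuous_real_toNNReal
  rw [continuous_iff_continuousAt]
  intro t₀
  have hvar : Tendsto (fun t => Var[fun ω => V t ω - V t₀ ω; P]) (nhds t₀) (nhds 0) := by
    have hZ : HasGaussianLaw (fun ω => V t₀ ω - V t₀ ω) P := hV.gaussian.hasGaussianLaw_fun_sub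
    have h := tendsto_variance_of_tendsto_ae (P := P) (l := nhds t₀)
      (X := fun t ω => V t ω - V t₀ ω) (Z := fun ω => V t₀ ω - V t₀ ω)
      (fun t => hV.gaussian.hasGaussianLaw_fun_sub) hZ
      (fun t => by
        rw [integral_sub ((hV.memLp_two t).integrable one_le_two)
          ((hV.memLp_two t₀).integrable one_le_two), hV.centered, hV.centered, sub_zero])
      (by simp)
      (by
        filter_upwards [hV.continuous] with ω hω
        exact (hω.sub continuous_const).tendsto t₀)
    have h0 : Var[fun ω => V t₀ ω - V t₀ ω; P] = 0 := by
      simp only [sub_self]; exact variance_zero P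
    rwa [h0] at h
  rw [ContinuousAt, tendsto_iff_norm_sub_tendsto_zero]
  have hbound : ∀ t, ‖cov[V 0, V t; P] - cov[V 0, V t₀; P]‖
      ≤ √(Var[V 0; P] * Var[fun ω => V t ω - V t₀ ω; P]) := fun t => by
    have h := sq_covariance_le_variance_mul_variance (hV.memLp_two 0)
      ((hV.memLp_two t).sub (hV.memLp_two t₀))
    rw [covariance_sub_right (hV.memLp_two _) (hV.memLp_two _) (hV.memLp_two _)] at h
    exact Real.abs_le_sqrt h
  refine squeeze_zero (fun _ => norm_nonneg _) hbound ?_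
  have := (Real.continuous_sqrt.tendsto _).comp (hvar.const_mul Var[V 0; P])
  simpa [Function.comp_def] using this

theorem IsFractionalOrnsteinUhlenbeck.abs_extendedAutocov_le
    (hV : IsFractionalOrnsteinUhlenbeck V lam s H P) (t : ℝ) :
    |extendedAutocov V P t| ≤ extendedAutocov V P 0 := by
  have := (hV.hasAutocovariance t.toNNReal).abs_le (fun _ => hV.memLp_two _) 1
  simpa [extendedAutocov] using this

/-- Riemann sums replace the pathwise integral of `V`: they are finite linear combinations of a
Gaussian process, so their variances are explicit and converge to that of `s (B t - B 0)`. -/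
theorem IsFractionalOrnsteinUhlenbeck.extendedAutocov_eq
    (hV : IsFractionalOrnsteinUhlenbeck V lam s H P) (hH : 0 < H) {t : ℝ} (ht : 0 ≤ t) :
    2 * (extendedAutocov V P 0 - extendedAutocov V P t)
      + 2 * lam ^ 2 * (∫ u in (0 : ℝ)..t, (t - u) * extendedAutocov V P u)
      = s ^ 2 * t ^ (2 * H) := by
  obtain ⟨B, hB, hLangevin⟩ := hV.langevin
  set r := extendedAutocov V P with hr
  have hrc : Continuous r := hV.continuous_extendedAutocov
  have hint : ∀ u, Integrable (V u) P := fun u => (hV.memLp_two u).integrable one_le_two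
  set δ : ℕ → ℝ≥0 := fun m => t.toNNReal / m with hδ
  set X : ℕ → Ω → ℝ := fun m ω => (V (m * δ m) ω - V ((0 : ℕ) * δ m) ω)
    + lam * (t / m) * ∑ k ∈ Finset.range m, V (k * δ m) ω with hX
  have hXgauss : ∀ m, HasGaussianLaw (X m) P := by
    intro m
    -- Indices 0 and 1 carry the two endpoint values; the nodes of the Riemann sum are shifted by 2.
    have h := hV.gaussian.hasGaussianLaw_linearCombination
      (fun k => if k = 0 then m * δ m else if k = 1 then 0 else (k - 2 : ℕ) * δ m)
      (fun k => if k = 0 then 1 else if k = 1 then -1 else lam * (t / m)) (m + 2)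
    refine h.congr (.of_forall fun ω => ?_)
    simp only [Finset.sum_range_succ', hX, Finset.mul_sum]
    simp
    ring
  have hXzero : ∀ m, ∫ ω, X m ω ∂P = 0 := by
    intro m
    have h1 : Integrable (fun ω => V (m * δ m) ω - V ((0 : ℕ) * δ m) ω) P := (hint _).sub (hint _)
    simp only [hX]
    rw [integral_add h1 ((integrable_finsetSum _ fun _ _ => hint _).const_mul _),
      integral_sub (hint _) (hint _), integral_const_mul, integral_finsetSum _ fun _ _ => hint _]
    simp [hV.centered]
  have hZgauss : HasGaussianLaw (fun ω => s * (B t ω - B 0 ω)) P :=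
    (hB.gaussian.hasGaussianLaw_fun_sub (s := t) (t := 0)).fun_smul s
  have hZzero : ∫ ω, s * (B t ω - B 0 ω) ∂P = 0 := by
    rw [integral_const_mul, integral_sub ((hB.memLp_two _).integrable one_le_two)
      ((hB.memLp_two _).integrable one_le_two), hB.centered, hB.centered]
    simp
  have hmδ : ∀ m : ℕ, 0 < m → m * δ m = t.toNNReal := fun m hm => by
    simp only [hδ]; field_simp
  have hkδ : ∀ k m : ℕ, (k : ℝ≥0) * δ m = ((k : ℝ) * (t / m)).toNNReal := fun k m => by
    rw [Real.toNNReal_mul (Nat.cast_nonneg k), Real.toNNReal_div ht]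
    simp [hδ]
  have hlim : ∀ᵐ ω ∂P, Tendsto (fun m => X m ω) atTop (nhds (s * (B t ω - B 0 ω))) := by
    filter_upwards [hV.continuous, hLangevin] with ω hω hL
    have hf : Continuous fun u : ℝ => V u.toNNReal ω := hω.comp continuous_real_toNNReal
    have h1 := ((tendsto_riemannSum hf ht).const_mul lam).const_add (V t.toNNReal ω - V 0 ω)
    have h2 := hL t.toNNReal
    rw [Real.coe_toNNReal t ht] at h2
    have h3 : s * (B t ω - B 0 ω)
        = V t.toNNReal ω - V 0 ω + lam * ∫ u in (0 : ℝ)..t, V u.toNNReal ω := by linarith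
    rw [h3]
    refine h1.congr' ?_
    filter_upwards [eventually_gt_atTop 0] with m hm
    simp only [hX, hmδ m hm]
    simp only [hkδ]
    simp
    ring
  have hvar := tendsto_variance_of_tendsto_ae hXgauss hZgauss hXzero hZzero hlim
  rw [variance_const_mul, hB.variance_sub hH ht] at hvar
  refine tendsto_nhds_unique ?_ hvar
  have hRiemann := tendsto_riemannSum (f := fun u => (t - u) * r u) (by fun_prop) ht
  have hinv : Tendsto (fun m : ℕ => t / m) atTop (nhds 0) := tendsto_const_div_atTop_nhds_zero_nat t
  -- The two multiples of `t / m` are the telescoped cross term and the diagonal correction; both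
  -- vanish in the limit.
  have h4 := (((hRiemann.const_mul (2 * lam ^ 2)).const_add (2 * (r 0 - r t))).add
    (hinv.const_mul (2 * lam * (r t - r 0)))).sub (hinv.const_mul (lam ^ 2 * (t * r 0)))
  simp only [mul_zero, add_zero, sub_zero] at h4
  refine h4.congr' ?_
  filter_upwards [eventually_gt_atTop 0] with m hm
  have hm' : (m : ℝ) ≠ 0 := by exact_mod_cast hm.ne'
  have hc : ∀ k : ℕ, cov[V 0, V (k * δ m); P] = r (k * (t / m)) := fun k => by
    rw [hkδ]; rfl
  have hmt : (m : ℝ) * (t / m) = t := by field_simp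
  have h5 := (hV.hasAutocovariance (δ m)).variance_sub_add_sum (fun _ => hV.memLp_two _)
    (lam * (t / m)) m
  simp only [hc] at h5
  simp only [hX]
  rw [h5, hmt]
  have h6 : t / m * ∑ k ∈ Finset.range m, (t - k * (t / m)) * r (k * (t / m))
      = (t / m) ^ 2 * ∑ k ∈ Finset.range m, ((m : ℝ) - k) * r (k * (t / m)) := by
    rw [pow_two, mul_assoc, Finset.mul_sum (a := t / m) (s := Finset.range m)
      (f := fun k => ((m : ℝ) - k) * r (k * (t / m)))]
    congr 1
    refine Finset.sum_congr rfl fun k _ => ?_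
    rw [← mul_assoc, mul_sub, mul_comm (t / m) (m : ℝ), hmt, mul_comm (t / m) (k : ℝ)]
  rw [h6]
  have h7 : lam ^ 2 * (t * r 0) * (t / m) = (lam * (t / m)) ^ 2 * (m * r 0) := by
    field_simp
  simp only [Nat.cast_zero, zero_mul]
  linear_combination (-1 : ℝ) * h7

theorem IsFractionalOUSequence.hasAutocovariance (hY : IsFractionalOUSequence Y lam s H P) :
    HasAutocovariance Y (autocov Y P) P := by
  obtain ⟨V, hV, hYV⟩ := hY
  have : Y = fun k : ℕ => V (k * 1) := by funext k ω; rw [hYV, mul_one]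
  have h := hV.hasAutocovariance 1
  rw [← this] at h
  rwa [h.eq_autocov]

theorem IsFractionalOUSequence.isBigO (hY : IsFractionalOUSequence Y lam s H P) (hH : 0 < H)
    (hH1 : H < 1) (hlam : 0 < lam) {α : ℝ} (hα : α = 2 * H) :
    (fun k : ℕ => autocov Y P k - s ^ 2 * α * (α - 1) / (2 * lam ^ 2) * (k : ℝ) ^ (α - 2))
        =O[atTop] fun k : ℕ => (k : ℝ) ^ (α - 3) := by
  obtain ⟨V, hV, hYV⟩ := hY
  have hYV' : ∀ k : ℕ, Y k = V k := fun k => funext (hYV k)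
  -- The constants come from halving the variance identity.
  have h := isBigO_sub_rpow_of_integral_eq (L := lam ^ 2) (c := s ^ 2 / 2) (a := α)
    (by positivity) hV.continuous_extendedAutocov hV.abs_extendedAutocov_le (by linarith)
    fun t ht => by
      have := hV.extendedAutocov_eq hH ht.le
      rw [hα]
      linarith
  refine (h.comp_tendsto tendsto_natCast_atTop_atTop).congr_left fun k => ?_
  simp only [Function.comp_apply, autocov, extendedAutocov, hYV', Nat.cast_zero,
    Real.toNNReal_natCast]
  congr 2
  field_simp

/-- If `r(0) = 0`, then `r` vanishes identically and the variance identity at `t = 1` reads `0 =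
s²`. -/
theorem IsFractionalOUSequence.autocov_zero_ne_zero (hY : IsFractionalOUSequence Y lam s H P)
    (hH : 0 < H) (hs : 0 < s) : autocov Y P 0 ≠ 0 := by
  obtain ⟨V, hV, hYV⟩ := hY
  intro h0
  have h1 : extendedAutocov V P 0 = 0 := by
    rw [autocov, show Y 0 = V 0 by funext ω; rw [hYV]; simp] at h0
    simpa [extendedAutocov] using h0
  have h2 : ∀ t, extendedAutocov V P t = 0 := fun t => by
    have := hV.abs_extendedAutocov_le t
    rw [h1] at this
    exact abs_nonpos_iff.1 this
  have h3 := hV.extendedAutocov_eq hH zero_le_one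
  simp only [h2, mul_zero, intervalIntegral.integral_zero, sub_zero, add_zero, Real.one_rpow,
    mul_one] at h3
  exact (pow_pos hs 2).ne h3

end OrnsteinUhlenbeck

/-! ### Normalized increments and conclusion -/

theorem HasAutocovariance.normalizedIncrement_properties {Ω : Type*} [MeasurableSpace Ω]
    {P : Measure Ω} [IsProbabilityMeasure P] {Y : ℕ → Ω → ℝ} {A α : ℝ}
    (hc : HasAutocovariance Y (autocov Y P) P) (hY : ∀ k, MemLp (Y k) 2 P)
    (h0 : autocov Y P 0 ≠ 0) (hα : α < 2)
    (hasymp : (fun k : ℕ => autocov Y P k - A * (k : ℝ) ^ (α - 2))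
      =O[atTop] fun k : ℕ => (k : ℝ) ^ (α - 3)) {n : ℕ} (hn : 0 < n) :
    (∀ k, variance (_root_.normalizedIncrement Y P n k) P = 1) ∧
    HasAutocovariance (_root_.normalizedIncrement Y P n)
      (autocov (_root_.normalizedIncrement Y P n) P) P ∧
    ((fun k : ℕ => autocov (_root_.normalizedIncrement Y P n) P k)
      =O[atTop] fun k : ℕ => (k : ℝ) ^ (α - 3)) ∧
    (Summable fun k : ℕ => |autocov (_root_.normalizedIncrement Y P n) P (k + 1)|) ∧
    (Summable fun k : ℕ => |autocov (_root_.normalizedIncrement Y P n) P (k + 1)| ^ 2) := by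
  have hlt := hc.lt_of_tendsto_zero hY h0 (tendsto_zero_of_isBigO_sub_rpow hα hasymp) hn
  have hZ := hc.normalizedIncrement hY n
  have hO : (fun k : ℕ => autocov (_root_.normalizedIncrement Y P n) P k)
      =O[atTop] fun k : ℕ => (k : ℝ) ^ (α - 3) := by
    rw [hZ.eq_autocov]
    exact (isBigO_second_difference n hasymp).const_mul_left _
  have hsum := summable_abs_of_isBigO_rpow (by linarith) hO
  have hsum1 := (summable_nat_add_iff 1).2 hsum
  refine ⟨hc.variance_normalizedIncrement hY hlt, by rwa [hZ.eq_autocov], hO, hsum1, ?_⟩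
  -- Squares are dominated by `γ(0) |γ(k+1)|`, since `|γ| ≤ γ(0)`.
  refine Summable.of_nonneg_of_le (fun k => sq_nonneg _) (fun k => ?_)
    (hsum1.mul_left (autocov (_root_.normalizedIncrement Y P n) P 0))
  have hZ2 : ∀ k, MemLp (_root_.normalizedIncrement Y P n k) 2 P := fun k =>
    ((hY _).sub (hY _)).const_mul _
  rw [pow_two]
  refine mul_le_mul_of_nonneg_right ?_ (abs_nonneg _)
  rw [hZ.eq_autocov]
  exact hZ.abs_le hZ2 _

theorem mainTheorem4 {Ω : Type*} [MeasurableSpace Ω] (P : Measure Ω) [IsProbabilityMeasure P]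
    (H α : ℝ) (hH0 : 0 < H) (hH1 : H < 1) (hα : α = 2 * H)
    (Y : ℕ → Ω → ℝ)
    (hY : IsFractionalGaussianNoise Y H P ∨
      (H ≠ 1 / 2 ∧ ∃ lam s : ℝ, 0 < lam ∧ 0 < s ∧ IsFractionalOUSequence Y lam s H P))
    (n : ℕ) (hn : 0 < n) :
    -- the normalized increments have unit variance, and `Y` and `Z_n` have autocovariance functions
    (∀ k, variance (normalizedIncrement Y P n k) P = 1) ∧
    HasAutocovariance Y (autocov Y P) P ∧
    HasAutocovariance (normalizedIncrement Y P n) (autocov (normalizedIncrement Y P n) P) P ∧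
    -- asymptotic expansion of the autocovariance of `Y`
    (IsFractionalGaussianNoise Y H P →
      (fun k : ℕ => autocov Y P k - α * (α - 1) / 2 * (k : ℝ) ^ (α - 2))
        =O[atTop] fun k : ℕ => (k : ℝ) ^ (α - 3)) ∧
    (∀ lam s : ℝ, 0 < lam → 0 < s → H ≠ 1 / 2 → IsFractionalOUSequence Y lam s H P →
      (fun k : ℕ => autocov Y P k - s ^ 2 * α * (α - 1) / (2 * lam ^ 2) * (k : ℝ) ^ (α - 2))
        =O[atTop] fun k : ℕ => (k : ℝ) ^ (α - 3)) ∧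
    -- decay and summability of the autocovariance of `Z_n`
    ((fun k : ℕ => autocov (normalizedIncrement Y P n) P k)
      =O[atTop] fun k : ℕ => (k : ℝ) ^ (α - 3)) ∧
    (Summable fun k : ℕ => |autocov (normalizedIncrement Y P n) P (k + 1)|) ∧
    (Summable fun k : ℕ => |autocov (normalizedIncrement Y P n) P (k + 1)| ^ 2) := by
  have hα2 : α < 2 := by linarith
  obtain ⟨A, hc, hLp, h0, hasymp⟩ : ∃ A : ℝ, HasAutocovariance Y (autocov Y P) P ∧
      (∀ k, MemLp (Y k) 2 P) ∧ autocov Y P 0 ≠ 0 ∧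
      ((fun k : ℕ => autocov Y P k - A * (k : ℝ) ^ (α - 2))
        =O[atTop] fun k : ℕ => (k : ℝ) ^ (α - 3)) := by
    rcases hY with hY | ⟨-, lam, s, hlam, hs, hY⟩
    · have h := hY.hasAutocovariance
      exact ⟨_, by rwa [h.eq_autocov], hY.memLp_two, hY.autocov_zero_ne_zero hH0, hY.isBigO hα⟩
    · exact ⟨_, hY.hasAutocovariance, hY.memLp_two, hY.autocov_zero_ne_zero hH0 hs,
        hY.isBigO hH0 hH1 hlam hα⟩
  obtain ⟨h1, h2, h3, h4, h5⟩ := hc.normalizedIncrement_properties hLp h0 hα2 hasymp hn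
  exact ⟨h1, hc, h2, fun hY => hY.isBigO hα,
    fun lam s hlam _ _ hY => hY.isBigO hH0 hH1 hlam hα, h3, h4, h5⟩
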